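/- Let $n \ge 1$ and $r \ge 0$. For $s>0$ let $\mu_s$ be the normalized surface measure on the sphere $\{w \in \mathbb{C}^n : |w| = s\}$, and for a continuous function $f:\mathbb{C}^n\to\mathbb{C}$ let $$f \times \mu_s(z) = \int_{|w|=s} f(z-w)\, e^{\frac{i}{2}\operatorname{Im}(z\cdot\bar w)}\, d\mu_s(w), \qquad z \in \mathbb{C}^n,$$ where $z\cdot\bar w=\sum_{j=1}^n z_j\bar w_j$, be its twisted spherical means. Let $f$ be a continuous function on $\mathbb{C}^n$ such that for each $k = 0, 1, 2, \dots$ there is a constant $C_k$ with $$|z|^k e^{\frac14 |z|^2} |f(z)| \le C_k \quad \text{for all } z \in \mathbb{C}^n.$$ Then $f$ is supported in $\{z : |z| \le r\}$ if and only if $f \times \mu_s(z) = 0$ for every $z \in \mathbb{C}^n$ and every $s > r + |z|$. -/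

import Mathlib

open MeasureTheory

/-- The space `ℂⁿ` with its Euclidean norm `|z| = (∑ j, |z j|²)^(1/2)`. -/
abbrev CSpace (n : ℕ) : Type := EuclideanSpace ℂ (Fin n)

/-- The normalized surface measure `μ_s` on the sphere `{z ∈ ℂⁿ : |z| = s}`, as a measure on `ℂⁿ`:
the surface measure that Lebesgue measure of `ℂⁿ = ℝ²ⁿ` induces on the unit sphere, divided by its
total mass and transported by the dilation `ω ↦ s ω`. -/
noncomputable def sphereMeasure (n : ℕ) (s : ℝ) : Measure (CSpace n) :=
  (((volume : Measure (CSpace n)).toSphere Set.univ)⁻¹ •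
    (volume : Measure (CSpace n)).toSphere).map
      (fun ω : Metric.sphere (0 : CSpace n) 1 => s • (ω : CSpace n))

/-- The twisted spherical mean
`f × μ_s (z) = ∫_{|w| = s} f (z - w) e^{(i/2) Im (z · w̄)} dμ_s(w)`,
where `z · w̄ = ∑ j, z j * conj (w j)`. -/
noncomputable def twistedSphericalMean {n : ℕ} (f : CSpace n → ℂ) (s : ℝ) (z : CSpace n) : ℂ :=
  ∫ w, f (z - w) *
    Complex.exp (Complex.I / 2 * (((∑ j, z j * (starRingEnd ℂ) (w j)).im : ℝ) : ℂ))
      ∂(sphereMeasure n s)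

open Filter Topology ContDiff

/-! Put g(u) = f(u) e^{-|u|²/4}. With u = z - w the twist and the Gaussian combine
(`sphere_kernel_eq`), and in polar coordinates vanishing means give K(g, ψ)(z) = ∫ g(u) e^{z̄·u/2}
ψ(|u - z|²) du = 0 for every z and every ψ supported beyond (r + |z|)². The gain is that the
exponential is antiholomorphic in z.

Applying ∂_z therefore hits only ψ: K(g·conj⟨v,u⟩, ψ') = 0. A functional that kills derivatives is
translation invariant, and here it tends to 0 along translations to infinity, so it vanishes:
factors ū can be inserted freely. Applying ∂_{z̄} to K(g, e^{t/2}χ) gives K(g·⟨v,u⟩, e^{t/2}χ') = 0,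
so each factor u costs one derivative.

These derivatives are removed only at the end, at z = 0. There the weights combine to e^{|u|²/4},
which the decay of f just absorbs; for z ≠ 0 an extra factor e^{-Re(z̄·u)/2} would remain. So f
e^{|u|²/4} φ(|u|²) is orthogonal to all polynomials in u and ū, and Stone–Weierstrass yields f = 0
where |u| > r. -/

/-- Smooth functions on the line supported in a compact interval of `(c, ∞)`. -/
def IsTest (c : ℝ) (φ : ℝ → ℂ) : Prop :=
  ContDiff ℝ ∞ φ ∧ ∃ a b : ℝ, c < a ∧ Function.support φ ⊆ Set.Icc a b

/-! ### Test functions on a half-line -/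

namespace IsTest

variable {c : ℝ} {φ ψ : ℝ → ℂ}

lemma differentiable (hφ : IsTest c φ) : Differentiable ℝ φ :=
  hφ.1.differentiable (by simp)

lemma continuous (hφ : IsTest c φ) : Continuous φ := hφ.1.continuous

lemma deriv (hφ : IsTest c φ) : IsTest c (_root_.deriv φ) := by
  obtain ⟨hφ, a, b, hc, hs⟩ := hφ
  exact ⟨(contDiff_infty_iff_deriv.1 hφ).2, a, b, hc,
    (support_deriv_subset).trans (closure_minimal hs isClosed_Icc)⟩

lemma mul (hφ : IsTest c φ) (hψ : ContDiff ℝ ∞ ψ) : IsTest c (fun t => ψ t * φ t) := by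
  obtain ⟨hφ, a, b, hc, hs⟩ := hφ
  exact ⟨hψ.mul hφ, a, b, hc, fun t ht => hs (right_ne_zero_of_mul ht)⟩

lemma translate (hφ : IsTest c φ) {N : ℝ} (hN : 0 ≤ N) : IsTest c (fun t => φ (t - N)) := by
  obtain ⟨hφ, a, b, hc, hs⟩ := hφ
  refine ⟨hφ.comp (contDiff_id.sub contDiff_const), a + N, b + N, by linarith, fun t ht => ?_⟩
  have := hs (show t - N ∈ Function.support φ from ht)
  exact ⟨by linarith [this.1], by linarith [this.2]⟩

lemma mono (hφ : IsTest c φ) {c' : ℝ} (h : c' ≤ c) : IsTest c' φ := by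
  obtain ⟨hφ, a, b, hc, hs⟩ := hφ
  exact ⟨hφ, a, b, h.trans_lt hc, hs⟩

/-- The slack below the support keeps a function admissible at z admissible at all nearby points,
which is what permits differentiating in z. -/
lemma exists_gt (hφ : IsTest c φ) : ∃ c' > c, IsTest c' φ := by
  obtain ⟨hφ, a, b, hc, hs⟩ := hφ
  exact ⟨(c + a) / 2, by linarith, hφ, a, b, by linarith, hs⟩

lemma eq_zero_of_le (hφ : IsTest c φ) {t : ℝ} (ht : t ≤ c) : φ t = 0 := by
  obtain ⟨-, a, b, hc, hs⟩ := hφ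
  by_contra h
  linarith [(hs h).1]

lemma hasCompactSupport (hφ : IsTest c φ) : HasCompactSupport φ := by
  obtain ⟨-, a, b, -, hs⟩ := hφ
  exact HasCompactSupport.of_support_subset_isCompact isCompact_Icc hs

lemma exists_bound (hφ : IsTest c φ) : ∃ M, ∀ t, ‖φ t‖ ≤ M :=
  hφ.hasCompactSupport.exists_bound_of_continuous hφ.continuous

/-- A primitive of φ alone need not have compact support, but χ(t) = ∫_{t-N}^t φ does. -/
lemma exists_deriv_eq_sub_translate (hφ : IsTest c φ) {N : ℝ} (hN : 0 ≤ N) :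
    ∃ χ, IsTest c χ ∧ _root_.deriv χ = φ - fun t => φ (t - N) := by
  have hcont := hφ.continuous
  obtain ⟨hφ, a, b, hc, hs⟩ := hφ
  set Φ : ℝ → ℂ := fun t => ∫ s in (0 : ℝ)..t, φ s with hΦ
  have hd : ∀ t, HasDerivAt Φ (φ t) t := fun t => hcont.integral_hasStrictDerivAt 0 t |>.hasDerivAt
  have hΦs : ContDiff ℝ ∞ Φ := by
    refine contDiff_infty_iff_deriv.2 ⟨fun t => (hd t).differentiableAt, ?_⟩
    rwa [show _root_.deriv Φ = φ from funext fun t => (hd t).deriv]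
  refine ⟨fun t => Φ t - Φ (t - N),
    ⟨hΦs.sub (hΦs.comp (contDiff_id.sub contDiff_const)), a, b + N, hc, fun t ht => ?_⟩, ?_⟩
  · by_contra hnot
    apply ht
    have hsub : Φ t - Φ (t - N) = ∫ s in (t - N)..t, φ s := by
      simp only [hΦ]
      rw [intervalIntegral.integral_interval_sub_left] <;> exact hcont.intervalIntegrable _ _
    change Φ t - Φ (t - N) = 0
    rw [hsub]
    refine intervalIntegral.integral_zero_ae ?_
    filter_upwards with s hst
    rw [Set.uIoc_of_le (by linarith)] at hst
    by_contra hne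
    have := hs hne
    exact hnot ⟨this.1.trans hst.2, by linarith [this.2, hst.1]⟩
  · funext t
    exact ((hd t).sub ((hd (t - N)).comp_sub_const t N)).deriv

lemma deriv_iterate (hφ : IsTest c φ) (k : ℕ) : IsTest c (_root_.deriv^[k] φ) := by
  induction k generalizing φ with
  | zero => exact hφ
  | succ k ih => exact ih hφ.deriv

lemma deriv_iterate_sub (hφ : IsTest c φ) (hψ : IsTest c ψ) (k : ℕ) :
    _root_.deriv^[k] (φ - ψ) = _root_.deriv^[k] φ - _root_.deriv^[k] ψ := by
  induction k generalizing φ ψ with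
  | zero => rfl
  | succ k ih =>
    have : _root_.deriv (φ - ψ) = _root_.deriv φ - _root_.deriv ψ :=
      funext fun t => deriv_sub (hφ.differentiable t) (hψ.differentiable t)
    simp only [Function.iterate_succ_apply, this]
    exact ih hφ.deriv hψ.deriv

lemma deriv_iterate_translate (φ : ℝ → ℂ) (N : ℝ) (k : ℕ) :
    _root_.deriv^[k] (fun t => φ (t - N)) = fun t => (_root_.deriv^[k] φ) (t - N) := by
  induction k generalizing φ with
  | zero => rfl
  | succ k ih =>
    have : _root_.deriv (fun t => φ (t - N)) = fun t => _root_.deriv φ (t - N) :=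
      funext fun t => deriv_comp_sub_const _ _ _
    simp only [Function.iterate_succ_apply, this]
    exact ih _

end IsTest

/-! ### Functionals that kill derivatives -/

/-- An additive functional on test functions that kills derivatives is translation invariant, so
it vanishes if it tends to zero along translations to infinity. -/
lemma eq_zero_of_deriv_eq_zero_of_tendsto {c : ℝ} {T : (ℝ → ℂ) → ℂ}
    (hsub : ∀ φ ψ, IsTest c φ → IsTest c ψ → T (φ - ψ) = T φ - T ψ)
    (hderiv : ∀ φ, IsTest c φ → T (deriv φ) = 0)
    (hlim : ∀ φ, IsTest c φ → Tendsto (fun N : ℕ => T (fun t => φ (t - N))) atTop (𝓝 0))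
    {φ : ℝ → ℂ} (hφ : IsTest c φ) : T φ = 0 := by
  have h : ∀ N : ℕ, T (fun t => φ (t - N)) = T φ := fun N => by
    obtain ⟨χ, hχ, he⟩ := hφ.exists_deriv_eq_sub_translate (Nat.cast_nonneg N)
    have := hderiv χ hχ
    rw [he, hsub _ _ hφ (hφ.translate (Nat.cast_nonneg N))] at this
    exact (sub_eq_zero.1 this).symm
  have := hlim φ hφ
  simp only [h] at this
  exact tendsto_nhds_unique tendsto_const_nhds this

/-- One derivative is peeled off at a time: `T ∘ deriv^[k]` is again additive, and tends to zero
along translations because translation commutes with differentiation. -/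
lemma eq_zero_of_deriv_iterate_eq_zero_of_tendsto {c : ℝ} {T : (ℝ → ℂ) → ℂ}
    (hsub : ∀ φ ψ, IsTest c φ → IsTest c ψ → T (φ - ψ) = T φ - T ψ) (k : ℕ)
    (hderiv : ∀ φ, IsTest c φ → T (deriv^[k] φ) = 0)
    (hlim : ∀ φ, IsTest c φ → Tendsto (fun N : ℕ => T (fun t => φ (t - N))) atTop (𝓝 0))
    {φ : ℝ → ℂ} (hφ : IsTest c φ) : T φ = 0 := by
  induction k generalizing φ with
  | zero => exact hderiv φ hφ
  | succ k ih =>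
    refine ih (fun ψ hψ => ?_) hφ
    refine eq_zero_of_deriv_eq_zero_of_tendsto (T := fun φ => T (deriv^[k] φ)) (fun φ ψ h h' => ?_)
      (fun φ h => hderiv φ h) (fun φ h => ?_) hψ
    · rw [IsTest.deriv_iterate_sub h h', hsub _ _ (h.deriv_iterate k) (h'.deriv_iterate k)]
    · simp only [IsTest.deriv_iterate_translate]
      exact hlim _ (h.deriv_iterate k)

/-! ### The kernel integral and its derivatives in z -/

variable {n : ℕ} {c : ℝ} {ψ : ℝ → ℂ}

/-- The integral `∫ g(u) e^{z̄·u/2} ψ(|u - z|²) du`. -/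
noncomputable def kernelIntegral (g : CSpace n → ℂ) (ψ : ℝ → ℂ) (z : CSpace n) : ℂ :=
  ∫ u, g u * (Complex.exp (inner ℂ z u / 2) * ψ (‖u - z‖ ^ 2))

lemma IsTest.exists_norm_le (hψ : IsTest c ψ) :
    ∃ R : ℝ, ∀ z u : CSpace n, R + ‖z‖ < ‖u‖ → ψ (‖u - z‖ ^ 2) = 0 := by
  obtain ⟨-, a, b, -, hs⟩ := hψ
  -- Since x ≤ x² + 1, ‖u - z‖² ≤ b forces ‖u‖ ≤ b + 1 + ‖z‖.
  refine ⟨b + 1, fun z u h => ?_⟩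
  by_contra hne
  have h1 := (hs hne).2
  have h2 := norm_sub_norm_le u z
  nlinarith [sq_nonneg (‖u - z‖ - 1), sq_nonneg (‖u - z‖)]

lemma hasDerivAt_norm_sub_sq (x v : CSpace n) (t : ℝ) :
    HasDerivAt (fun t : ℝ => ‖x - (t : ℂ) • v‖ ^ 2) (-2 * (inner ℂ v (x - (t : ℂ) • v)).re) t := by
  have h : (fun t : ℝ => ‖x - (t : ℂ) • v‖ ^ 2) =
      fun t : ℝ => ‖x‖ ^ 2 - 2 * (t * (inner ℂ v x).re) + t ^ 2 * ‖v‖ ^ 2 := by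
    funext t
    rw [norm_sub_sq (𝕜 := ℂ), inner_smul_right, norm_smul]
    have : (inner ℂ x v).re = (inner ℂ v x).re := inner_re_symm (𝕜 := ℂ) x v
    simp [mul_pow, this]
  rw [h]
  have h1 : HasDerivAt (fun t : ℝ => ‖x‖ ^ 2 - 2 * (t * (inner ℂ v x).re) + t ^ 2 * ‖v‖ ^ 2)
      (-(2 * (1 * (inner ℂ v x).re)) + (2 * t) * ‖v‖ ^ 2) t := by
    refine HasDerivAt.add ((((hasDerivAt_id t).mul_const _).const_mul 2).const_sub _) ?_
    simpa using (hasDerivAt_pow 2 t).mul_const (‖v‖ ^ 2)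
  convert h1 using 1
  rw [inner_sub_right, inner_smul_right, inner_self_eq_norm_sq_to_K]
  simp [← Complex.ofReal_pow]
  ring

lemma hasDerivAt_kernel (g : CSpace n → ℂ) (hψ : Differentiable ℝ ψ) (z v u : CSpace n) (t : ℝ) :
    HasDerivAt (fun t : ℝ => g u * (Complex.exp (inner ℂ (z + (t : ℂ) • v) u / 2) *
        ψ (‖u - (z + (t : ℂ) • v)‖ ^ 2)))
      (g u * (Complex.exp (inner ℂ (z + (t : ℂ) • v) u / 2) *
        (inner ℂ v u / 2 * ψ (‖u - (z + (t : ℂ) • v)‖ ^ 2)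
          - 2 * ((inner ℂ v (u - (z + (t : ℂ) • v))).re : ℂ) *
            deriv ψ (‖u - (z + (t : ℂ) • v)‖ ^ 2)))) t := by
  have h1 : HasDerivAt (fun t : ℝ => Complex.exp (inner ℂ (z + (t : ℂ) • v) u / 2))
      (Complex.exp (inner ℂ (z + (t : ℂ) • v) u / 2) * (inner ℂ v u / 2)) t := by
    refine HasDerivAt.cexp ?_
    have : (fun t : ℝ => inner ℂ (z + (t : ℂ) • v) u / 2) =
        fun t : ℝ => (inner ℂ z u + (t : ℂ) * inner ℂ v u) / 2 := by
      funext t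
      rw [inner_add_left, inner_smul_left, Complex.conj_ofReal]
    rw [this]
    have h0 : HasDerivAt (fun t : ℝ => (t : ℂ)) 1 t := Complex.ofRealCLM.hasDerivAt
    simpa using ((h0.mul_const (inner ℂ v u)).const_add (inner ℂ z u)).div_const 2
  have h2 := hasDerivAt_norm_sub_sq (u - z) v t
  simp only [sub_sub] at h2
  have h3 := (hψ (‖u - (z + (t : ℂ) • v)‖ ^ 2)).hasDerivAt.scomp t h2
  refine ((h1.mul h3).const_mul (g u)).congr_deriv ?_
  simp only [Function.comp_apply, Complex.real_smul]
  push_cast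
  ring

lemma integrable_kernel {g : CSpace n → ℂ} (hg : Continuous g) (hψ : IsTest c ψ) (z : CSpace n) :
    Integrable (fun u => g u * (Complex.exp (inner ℂ z u / 2) * ψ (‖u - z‖ ^ 2))) := by
  have := hψ.continuous
  refine Continuous.integrable_of_hasCompactSupport (by fun_prop) ?_
  obtain ⟨R, hR⟩ := hψ.exists_norm_le (n := n)
  refine HasCompactSupport.of_support_subset_isCompact
    (isCompact_closedBall (0 : CSpace n) (R + ‖z‖)) fun u hu => ?_
  rw [mem_closedBall_zero_iff]
  by_contra! h
  exact hu (by simp [hR z u h])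

lemma hasDerivAt_kernelIntegral {g : CSpace n → ℂ} (hg : Continuous g) (hψ : IsTest c ψ)
    (z v : CSpace n) :
    Integrable (fun u => g u * (Complex.exp (inner ℂ z u / 2) *
        (inner ℂ v u / 2 * ψ (‖u - z‖ ^ 2)
          - 2 * ((inner ℂ v (u - z)).re : ℂ) * deriv ψ (‖u - z‖ ^ 2)))) ∧
    HasDerivAt (fun t : ℝ => kernelIntegral g ψ (z + (t : ℂ) • v))
      (∫ u, g u * (Complex.exp (inner ℂ z u / 2) *
        (inner ℂ v u / 2 * ψ (‖u - z‖ ^ 2)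
          - 2 * ((inner ℂ v (u - z)).re : ℂ) * deriv ψ (‖u - z‖ ^ 2)))) 0 := by
  have hc := hψ.continuous
  have hc' := hψ.deriv.continuous
  set F' : ℝ → CSpace n → ℂ := fun t u => g u * (Complex.exp (inner ℂ (z + (t : ℂ) • v) u / 2) *
        (inner ℂ v u / 2 * ψ (‖u - (z + (t : ℂ) • v)‖ ^ 2)
          - 2 * ((inner ℂ v (u - (z + (t : ℂ) • v))).re : ℂ) *
            deriv ψ (‖u - (z + (t : ℂ) • v)‖ ^ 2))) with hF'
  obtain ⟨R, hR⟩ := hψ.exists_norm_le (n := n)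
  obtain ⟨R', hR'⟩ := hψ.deriv.exists_norm_le (n := n)
  -- For |t| ≤ 1 all integrands are supported in this one ball, so a constant on it dominates.
  set ρ := max R R' + (‖z‖ + ‖v‖) with hρ
  have hcontF' : Continuous (Function.uncurry F') := by
    have hre := Complex.continuous_re
    have ho := Complex.continuous_ofReal
    simp only [hF', Function.uncurry_def]
    fun_prop
  obtain ⟨M, hM⟩ := ((isCompact_Icc (a := (-1 : ℝ)) (b := 1)).prod
    (isCompact_closedBall (0 : CSpace n) ρ)).exists_bound_of_continuousOn hcontF'.continuousOn
  have key := hasDerivAt_integral_of_dominated_loc_of_deriv_le (μ := (volume : Measure (CSpace n)))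
    (F := fun (t : ℝ) u => g u * (Complex.exp (inner ℂ (z + (t : ℂ) • v) u / 2) *
        ψ (‖u - (z + (t : ℂ) • v)‖ ^ 2))) (F' := F') (x₀ := (0 : ℝ)) (s := Set.Icc (-1) 1)
    (bound := (Metric.closedBall (0 : CSpace n) ρ).indicator fun _ => M)
    (Icc_mem_nhds (by norm_num) (by norm_num))
    (Eventually.of_forall fun t => (integrable_kernel hg hψ _).aestronglyMeasurable)
    (integrable_kernel hg hψ _)
    (hcontF'.comp (by fun_prop : Continuous fun u : CSpace n => ((0 : ℝ), u))).aestronglyMeasurable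
    (Eventually.of_forall fun u t ht => ?_) ?_
    (Eventually.of_forall fun u t _ => hasDerivAt_kernel g hψ.differentiable z v u t)
  · simpa [hF', kernelIntegral] using key
  · by_cases hu : u ∈ Metric.closedBall (0 : CSpace n) ρ
    · rw [Set.indicator_of_mem hu]
      exact hM (t, u) ⟨ht, hu⟩
    · rw [Set.indicator_of_notMem hu]
      rw [mem_closedBall_zero_iff, not_le] at hu
      have h1 : ‖z + (t : ℂ) • v‖ ≤ ‖z‖ + ‖v‖ := by
        refine (norm_add_le _ _).trans ?_
        rw [norm_smul]
        have : ‖(t : ℂ)‖ ≤ 1 := by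
          rw [Complex.norm_real, Real.norm_eq_abs, abs_le]; exact ht
        nlinarith [norm_nonneg v]
      rw [hF']
      simp only
      rw [hR _ u (by linarith [le_max_left R R']), hR' _ u (by linarith [le_max_right R R'])]
      simp
  · exact (integrable_indicator_iff measurableSet_closedBall).2
      (integrableOn_const (isCompact_closedBall _ _).measure_lt_top.ne)

lemma kernelIntegral_sub {g : CSpace n → ℂ} (hg : Continuous g) {φ : ℝ → ℂ} (hφ : IsTest c φ)
    (hψ : IsTest c ψ) (z : CSpace n) :
    kernelIntegral g (φ - ψ) z = kernelIntegral g φ z - kernelIntegral g ψ z := by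
  rw [kernelIntegral, kernelIntegral, kernelIntegral,
    ← integral_sub (integrable_kernel hg hφ z) (integrable_kernel hg hψ z)]
  congr 1 with u
  simp only [Pi.sub_apply]
  ring

open ComplexConjugate in
/-- The `∂_z` and `∂_{z̄}` derivatives of `kernelIntegral g ψ` in the direction `v`. -/
lemma kernelIntegral_wirtinger {g : CSpace n → ℂ} (hg : Continuous g) (hψ : IsTest c ψ)
    {z : CSpace n} (h : ∀ᶠ z' in 𝓝 z, kernelIntegral g ψ z' = 0) (v : CSpace n) :
    kernelIntegral (fun u => g u * conj (inner ℂ v u)) (deriv ψ) z =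
        conj (inner ℂ v z) * kernelIntegral g (deriv ψ) z ∧
    kernelIntegral (fun u => g u * inner ℂ v u) ψ z =
        2 * kernelIntegral (fun u => g u * inner ℂ v u) (deriv ψ) z -
          2 * (inner ℂ v z * kernelIntegral g (deriv ψ) z) := by
  have hzero : ∀ w : CSpace n, ∫ u, g u * (Complex.exp (inner ℂ z u / 2) *
        (inner ℂ w u / 2 * ψ (‖u - z‖ ^ 2)
          - 2 * ((inner ℂ w (u - z)).re : ℂ) * deriv ψ (‖u - z‖ ^ 2))) = 0 := fun w => by
    have hd := (hasDerivAt_kernelIntegral hg hψ z w).2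
    have hcont : ContinuousAt (fun t : ℝ => z + (t : ℂ) • w) 0 := by fun_prop
    have hev : (fun t : ℝ => kernelIntegral g ψ (z + (t : ℂ) • w)) =ᶠ[𝓝 0] fun _ => (0 : ℂ) := by
      refine hcont.eventually (p := fun z' => kernelIntegral g ψ z' = 0) ?_
      simpa using h
    exact hd.unique ((hasDerivAt_const (0 : ℝ) (0 : ℂ)).congr_of_eventuallyEq hev)
  have hint := fun w => (hasDerivAt_kernelIntegral hg hψ z w).1
  have h1 := hzero v
  have h2 := hzero (Complex.I • v)
  have i1 := hint v
  have i2 := hint (Complex.I • v)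
  have hre : ∀ u : CSpace n, ((inner ℂ v (u - z)).re : ℂ) =
      (inner ℂ v (u - z) + conj (inner ℂ v (u - z))) / 2 := fun u => by
    rw [Complex.re_eq_add_conj]
  have him : ∀ u : CSpace n, ((inner ℂ (Complex.I • v) (u - z)).re : ℂ) =
      (-Complex.I * inner ℂ v (u - z) + Complex.I * conj (inner ℂ v (u - z))) / 2 := fun u => by
    rw [Complex.re_eq_add_conj, inner_smul_left]
    simp only [map_mul, Complex.conj_I, map_neg, neg_neg]
  have hvu : ∀ u : CSpace n, inner ℂ (Complex.I • v) u = -Complex.I * inner ℂ v u := fun u => by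
    rw [inner_smul_left]; simp
  have hsm : Continuous fun u : CSpace n => inner ℂ v u := by fun_prop
  have hsc : Continuous fun u : CSpace n => conj (inner ℂ v u) :=
    Complex.continuous_conj.comp hsm
  have j0 := integrable_kernel hg hψ.deriv z
  have j1 := integrable_kernel (g := fun u => g u * inner ℂ v u) (hg.mul hsm) hψ z
  have j2 := integrable_kernel (g := fun u => g u * inner ℂ v u) (hg.mul hsm) hψ.deriv z
  have j3 := integrable_kernel (g := fun u => g u * conj (inner ℂ v u)) (hg.mul hsc) hψ.deriv z
  constructor
  -- With D_w the real directional derivative, D_v - i D_{iv} is twice the ∂_z derivative: the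
  -- exponential drops out and -2 conj⟨v, u - z⟩ ψ' remains. The sum D_v + i D_{iv} below gives
  -- ∂_{z̄}.
  · have h3 := integral_sub i1 (i2.const_mul Complex.I)
    rw [integral_const_mul, h1, h2] at h3
    simp only [mul_zero, sub_zero] at h3
    have h4 : kernelIntegral (fun u => g u * conj (inner ℂ v u)) (deriv ψ) z -
        conj (inner ℂ v z) * kernelIntegral g (deriv ψ) z = 0 := by
      rw [kernelIntegral, kernelIntegral, ← integral_const_mul,
        ← integral_sub j3 (j0.const_mul _)]
      refine (mul_eq_zero_iff_left (a := (-2 : ℂ)) (show (-2 : ℂ) ≠ 0 by norm_num)).1 ?_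
      rw [← integral_const_mul, ← h3]
      congr 1 with u
      rw [hre, him, hvu, inner_sub_right, map_sub]
      linear_combination -(g u * Complex.exp (inner ℂ z u / 2) *
        (inner ℂ v u / 2 * ψ (‖u - z‖ ^ 2) + (conj (inner ℂ v u) - conj (inner ℂ v z) -
          (inner ℂ v u - inner ℂ v z)) * deriv ψ (‖u - z‖ ^ 2))) * Complex.I_sq
    exact sub_eq_zero.1 h4
  · have h3 := integral_add i1 (i2.const_mul Complex.I)
    rw [integral_const_mul, h1, h2] at h3
    simp only [mul_zero, add_zero] at h3
    have h4 : kernelIntegral (fun u => g u * inner ℂ v u) ψ z -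
        (2 * kernelIntegral (fun u => g u * inner ℂ v u) (deriv ψ) z -
          2 * (inner ℂ v z * kernelIntegral g (deriv ψ) z)) = 0 := by
      rw [kernelIntegral, kernelIntegral, kernelIntegral, ← integral_const_mul,
        ← integral_const_mul, ← integral_const_mul,
        ← integral_sub (j2.const_mul _) ((j0.const_mul _).const_mul _)]
      refine (integral_sub j1 ((j2.const_mul _).sub ((j0.const_mul _).const_mul _))).symm.trans ?_
      rw [← h3]
      congr 1 with u
      simp only [Pi.sub_apply]
      rw [hre, him, hvu, inner_sub_right, map_sub]
      linear_combination (g u * Complex.exp (inner ℂ z u / 2) *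
        (inner ℂ v u / 2 * ψ (‖u - z‖ ^ 2) + (conj (inner ℂ v u) - conj (inner ℂ v z) -
          (inner ℂ v u - inner ℂ v z)) * deriv ψ (‖u - z‖ ^ 2))) * Complex.I_sq
    exact sub_eq_zero.1 h4

lemma eventually_sq_add_norm_lt {r c : ℝ} {z : CSpace n} (h : (r + ‖z‖) ^ 2 < c) :
    ∀ᶠ z' in 𝓝 z, (r + ‖z'‖) ^ 2 < c :=
  (by fun_prop : Continuous fun z : CSpace n => (r + ‖z‖) ^ 2).continuousAt.eventually_lt_const h

/-- The translates are uniformly bounded and eventually vanish at each point, so integrability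
against the weight `w` alone gives dominated convergence. -/
lemma tendsto_kernelIntegral_translate {g : CSpace n → ℂ} {w : ℝ → ℂ} {z : CSpace n}
    (hw : Continuous w) (hg : Continuous g)
    (hint : Integrable fun u => g u * (Complex.exp (inner ℂ z u / 2) * w (‖u - z‖ ^ 2)))
    (hψ : IsTest c ψ) :
    Tendsto (fun N : ℕ => kernelIntegral g (fun t => w t * ψ (t - N)) z) atTop (𝓝 0) := by
  obtain ⟨M, hM⟩ := hψ.exists_bound
  have hc := hψ.continuous
  rw [← integral_zero (CSpace n) ℂ]
  refine tendsto_integral_of_dominated_convergence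
    (fun u => ‖g u * (Complex.exp (inner ℂ z u / 2) * w (‖u - z‖ ^ 2))‖ * M)
    (fun N => Continuous.aestronglyMeasurable (by fun_prop)) (hint.norm.mul_const M)
    (fun N => Eventually.of_forall fun u => ?_) (Eventually.of_forall fun u => ?_)
  · rw [← mul_assoc (Complex.exp _), ← mul_assoc, norm_mul]
    exact mul_le_mul_of_nonneg_left (hM _) (norm_nonneg _)
  · refine tendsto_const_nhds.congr' ?_
    filter_upwards [eventually_ge_atTop ⌈‖u - z‖ ^ 2 - c⌉₊] with N hN
    have : ‖u - z‖ ^ 2 - c ≤ N := (Nat.le_ceil _).trans (by exact_mod_cast hN)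
    rw [hψ.eq_zero_of_le (by linarith)]
    simp

/-! ### Inserting factors ū and u -/

open ComplexConjugate in
lemma kernelIntegral_mul_conj_inner_eq_zero {r : ℝ} {g : CSpace n → ℂ} (hg : Continuous g)
    (h : ∀ z ψ, IsTest ((r + ‖z‖) ^ 2) ψ → kernelIntegral g ψ z = 0) (v : CSpace n)
    (hint : ∀ z : CSpace n,
      Integrable fun u => g u * conj (inner ℂ v u) * Complex.exp (inner ℂ z u / 2))
    (z : CSpace n) (ψ : ℝ → ℂ) (hψ : IsTest ((r + ‖z‖) ^ 2) ψ) :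
    kernelIntegral (fun u => g u * conj (inner ℂ v u)) ψ z = 0 := by
  have hg' : Continuous fun u => g u * conj (inner ℂ v u) :=
    hg.mul (Complex.continuous_conj.comp (by fun_prop))
  refine eq_zero_of_deriv_eq_zero_of_tendsto
    (T := fun ψ => kernelIntegral (fun u => g u * conj (inner ℂ v u)) ψ z)
    (fun φ ψ hφ hψ => kernelIntegral_sub hg' hφ hψ z) (fun φ hφ => ?_) (fun φ hφ => ?_) hψ
  · obtain ⟨c', hc', hφ'⟩ := hφ.exists_gt
    have hev : ∀ᶠ z' in 𝓝 z, kernelIntegral g φ z' = 0 := by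
      filter_upwards [eventually_sq_add_norm_lt hc'] with z' hz'
      exact h z' φ (hφ'.mono hz'.le)
    rw [(kernelIntegral_wirtinger hg hφ hev v).1, h z _ hφ.deriv, mul_zero]
  · simpa using tendsto_kernelIntegral_translate (w := fun _ => 1) (z := z) continuous_const hg'
      (by simpa using hint z) hφ

lemma contDiff_exp_half : ContDiff ℝ ∞ fun t : ℝ => Complex.exp (t / 2) :=
  (Complex.ofRealCLM.contDiff.div_const 2).cexp

lemma deriv_exp_half_mul (hψ : IsTest c ψ) :
    deriv (fun t : ℝ => Complex.exp (t / 2) * ψ t) =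
      fun t : ℝ => Complex.exp (t / 2) * (deriv ψ t + ψ t / 2) := by
  funext t
  have h0 : HasDerivAt (fun t : ℝ => (t : ℂ) / 2) (1 / 2) t :=
    (Complex.ofRealCLM.hasDerivAt (x := t)).div_const 2
  refine (h0.cexp.mul (hψ.differentiable t).hasDerivAt).deriv.trans ?_
  ring

lemma kernelIntegral_exp_mul_add {g : CSpace n → ℂ} (hg : Continuous g) {φ : ℝ → ℂ}
    (hφ : IsTest c φ) (hψ : IsTest c ψ) (z : CSpace n) :
    kernelIntegral g (fun t => Complex.exp (t / 2) * (φ t + ψ t / 2)) z =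
      kernelIntegral g (fun t => Complex.exp (t / 2) * φ t) z +
        kernelIntegral g (fun t => Complex.exp (t / 2) * ψ t) z / 2 := by
  have h1 := integrable_kernel hg (hφ.mul contDiff_exp_half) z
  have h2 := integrable_kernel hg (hψ.mul contDiff_exp_half) z
  rw [kernelIntegral, kernelIntegral, kernelIntegral, ← integral_div,
    ← integral_add h1 (h2.div_const 2)]
  congr 1 with u
  ring

/-- The weight e^{t/2} solves ψ = 2ψ': for ψ = e^{t/2}χ one has ψ - 2ψ' = -2e^{t/2}χ', so the ∂_{z̄}
relation leaves a single term in χ'. -/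
lemma kernelIntegral_mul_inner_eq_zero {r : ℝ} {g : CSpace n → ℂ} (hg : Continuous g) (k : ℕ)
    (h : ∀ z φ, IsTest ((r + ‖z‖) ^ 2) φ →
      kernelIntegral g (fun t => Complex.exp (t / 2) * deriv^[k] φ t) z = 0) (v : CSpace n)
    (z : CSpace n) (φ : ℝ → ℂ) (hφ : IsTest ((r + ‖z‖) ^ 2) φ) :
    kernelIntegral (fun u => g u * inner ℂ v u)
      (fun t => Complex.exp (t / 2) * deriv^[k + 1] φ t) z = 0 := by
  have hg' : Continuous fun u => g u * inner ℂ v u := by fun_prop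
  have hχ := hφ.deriv_iterate k
  have hχ' : deriv (deriv^[k] φ) = deriv^[k + 1] φ := (Function.iterate_succ_apply' deriv k φ).symm
  have hev : ∀ᶠ z' in 𝓝 z,
      kernelIntegral g (fun t => Complex.exp (t / 2) * deriv^[k] φ t) z' = 0 := by
    obtain ⟨c', hc', hφ'⟩ := hφ.exists_gt
    filter_upwards [eventually_sq_add_norm_lt hc'] with z' hz'
    exact h z' φ (hφ'.mono hz'.le)
  have key := (kernelIntegral_wirtinger hg (hχ.mul contDiff_exp_half) hev v).2
  rw [deriv_exp_half_mul hχ, kernelIntegral_exp_mul_add hg hχ.deriv hχ,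
    kernelIntegral_exp_mul_add hg' hχ.deriv hχ, h z φ hφ, hχ'] at key
  have h0 := h z _ hφ.deriv
  rw [← Function.iterate_succ_apply] at h0
  rw [h0] at key
  linear_combination (-1 / 2 : ℂ) * key

/-! ### Polar coordinates and Stone–Weierstrass -/

/-- Spherical means of `h` vanishing on all spheres around the origin force `∫ h = 0`. -/
lemma integral_eq_zero_of_integral_toSphere_eq_zero {E : Type*} [NormedAddCommGroup E]
    [NormedSpace ℝ E] [MeasurableSpace E] [BorelSpace E] [FiniteDimensional ℝ E] [Nontrivial E]
    (μ : Measure E) [μ.IsAddHaarMeasure] {h : E → ℂ} (hint : Integrable h μ)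
    (hs : ∀ s : ℝ, 0 < s → ∫ x : Metric.sphere (0 : E) 1, h (s • (x : E)) ∂μ.toSphere = 0) :
    ∫ x, h x ∂μ = 0 := by
  have hmp := (μ.measurePreserving_homeomorphUnitSphereProd).symm
    (homeomorphUnitSphereProd E).toMeasurableEquiv
  have hemb := ((homeomorphUnitSphereProd E).toMeasurableEquiv).symm.measurableEmbedding
  have hm0 : MeasurableSet ({0}ᶜ : Set E) := (measurableSet_singleton _).compl
  have h1 := hmp.integral_comp hemb (fun x => h x)
  rw [integral_subtype_comap hm0 h, restrict_compl_singleton] at h1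
  rw [← h1, integral_prod_symm]
  · refine integral_eq_zero_of_ae (Eventually.of_forall fun s => ?_)
    simpa using hs s.1 s.2
  · refine (hmp.integrable_comp_emb hemb (g := fun x => h x)).2 ?_
    have := (integrableOn_iff_comap_subtypeVal hm0 (f := h) (μ := μ)).1 hint.integrableOn
    exact this

/-- A continuous function orthogonal over a closed ball to all polynomials in `z` and `z̄` vanishes
on the ball. -/
lemma eq_zero_of_forall_setIntegral_mul_prod_inner_eq_zero {F : CSpace n → ℂ} (hF : Continuous F)
    (ρ : ℝ) (hout : ∀ u, ρ < ‖u‖ → F u = 0)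
    (h : ∀ L M : List (CSpace n), ∫ u, F u * ((L.map fun v => inner ℂ u v).prod *
      (M.map fun v => inner ℂ v u).prod) = 0) (u : CSpace n) : F u = 0 := by
  classical
  set K := Metric.closedBall (0 : CSpace n) ρ with hK
  have hcK : IsCompact K := isCompact_closedBall _ _
  have : CompactSpace K := isCompact_iff_compactSpace.1 hcK
  let a : CSpace n → C(K, ℂ) := fun v => ⟨fun x => inner ℂ v (x : CSpace n), by fun_prop⟩
  set A : StarSubalgebra ℂ C(K, ℂ) := StarAlgebra.adjoin ℂ (Set.range a) with hA
  have hFi : Integrable F := hF.integrable_of_hasCompactSupport <|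
    HasCompactSupport.of_support_subset_isCompact hcK fun x hx => by
      rw [mem_closedBall_zero_iff]; by_contra! hlt; exact hx (hout x hlt)
  have hmul : ∀ q : C(K, ℂ), Integrable (fun x : K => F x * q x) (volume.comap Subtype.val) := by
    intro q
    have h0 : Integrable (fun x : K => F x) (volume.comap Subtype.val) :=
      (integrableOn_iff_comap_subtypeVal measurableSet_closedBall).1 hFi.integrableOn
    exact h0.mul_bdd (c := ‖q‖) q.continuous.aestronglyMeasurable
      (Eventually.of_forall fun x => q.norm_coe_le_norm x)
  have htop : A.topologicalClosure = ⊤ := by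
    refine ContinuousMap.starSubalgebra_topologicalClosure_eq_top_of_separatesPoints A ?_
    intro x y hxy
    have hne : (x : CSpace n) - y ≠ 0 := fun h => hxy (Subtype.ext (sub_eq_zero.1 h))
    -- Pairing with x - y separates x from y, the difference of values being ‖x - y‖².
    refine ⟨a (x - y), ⟨a (x - y), StarAlgebra.subset_adjoin ℂ _ ⟨_, rfl⟩, rfl⟩, fun he => ?_⟩
    have : inner ℂ ((x : CSpace n) - y) ((x : CSpace n) - y) = 0 := by
      rw [inner_sub_right]
      exact sub_eq_zero.2 he
    exact hne (inner_self_eq_zero.1 this)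
  have hzero : ∀ q ∈ A, ∫ x : K, F x * q x ∂(volume.comap Subtype.val) = 0 := by
    intro q hq
    have hq' : q ∈ Submodule.span ℂ (Submonoid.closure (Set.range a ∪ star (Set.range a)) :
        Set C(K, ℂ)) := by
      rw [← Algebra.adjoin_eq_span]
      exact hq
    clear hq
    induction hq' using Submodule.span_induction with
    | mem q hmem =>
      have : ∃ L M : List (CSpace n), ∀ x : K, q x = (L.map fun v => inner ℂ (x : CSpace n) v).prod *
          (M.map fun v => inner ℂ v (x : CSpace n)).prod := by
        induction hmem using Submonoid.closure_induction with
        | mem q hq =>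
          rcases hq with ⟨v, rfl⟩ | hq
          · exact ⟨[], [v], fun x => by simp [a]⟩
          · obtain ⟨v, hv⟩ := Set.mem_star.1 hq
            refine ⟨[v], [], fun x => ?_⟩
            rw [← star_star q, ← hv]
            simp [a]
        | one => exact ⟨[], [], fun x => by simp⟩
        | mul p q _ _ hp hq =>
          obtain ⟨L, M, hp⟩ := hp
          obtain ⟨L', M', hq⟩ := hq
          refine ⟨L ++ L', M ++ M', fun x => ?_⟩
          simp only [ContinuousMap.mul_apply, hp, hq, List.map_append, List.prod_append]
          ring
      obtain ⟨L, M, hLM⟩ := this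
      simp only [hLM]
      rw [integral_subtype_comap measurableSet_closedBall (fun x => F x *
        ((L.map fun v => inner ℂ x v).prod * (M.map fun v => inner ℂ v x).prod)),
        setIntegral_eq_integral_of_forall_compl_eq_zero, h L M]
      intro x hx
      rw [mem_closedBall_zero_iff, not_le] at hx
      simp [hout x hx]
    | zero => simp
    | add p q _ _ hp hq =>
      simp only [ContinuousMap.add_apply, mul_add]
      rw [integral_add (hmul p) (hmul q), hp, hq, add_zero]
    | smul c q _ hq =>
      simp only [ContinuousMap.smul_apply, smul_eq_mul, mul_left_comm _ c]
      rw [integral_const_mul, hq, mul_zero]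
  -- Approximating conj F uniformly by polynomials turns orthogonality into ∫ |F|² = 0.
  let q : C(K, ℂ) := ⟨fun x => star (F x), by fun_prop⟩
  have hq : ∫ x : K, F x * q x ∂(volume.comap Subtype.val) = 0 := by
    set C := ∫ x : K, ‖F x‖ ∂(volume.comap Subtype.val) with hC
    have hle : ∀ ε > 0, ‖∫ x : K, F x * q x ∂(volume.comap Subtype.val)‖ ≤ C * ε := by
      intro ε hε
      have hqm : q ∈ closure (A : Set C(K, ℂ)) := by
        rw [← StarSubalgebra.topologicalClosure_coe, htop]
        trivial
      obtain ⟨p, hp, hpq⟩ := Metric.mem_closure_iff.1 hqm ε hε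
      rw [← sub_zero (∫ x : K, F x * q x ∂_), ← hzero p hp, ← integral_sub (hmul q) (hmul p),
        hC, ← integral_mul_const]
      refine norm_integral_le_of_norm_le ?_ (Eventually.of_forall fun x => ?_)
      · exact ((integrableOn_iff_comap_subtypeVal measurableSet_closedBall).1
          hFi.integrableOn).norm.mul_const ε
      · rw [← mul_sub, norm_mul]
        refine mul_le_mul_of_nonneg_left ?_ (norm_nonneg _)
        rw [← dist_eq_norm]
        exact (ContinuousMap.dist_apply_le_dist x).trans hpq.le
    have htend : Tendsto (fun ε : ℝ => C * ε) (𝓝[>] 0) (𝓝 0) := by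
      have : Tendsto (fun ε : ℝ => C * ε) (𝓝 0) (𝓝 (C * 0)) :=
        (continuous_const_mul C).tendsto 0
      rw [mul_zero] at this
      exact this.mono_left nhdsWithin_le_nhds
    exact norm_le_zero_iff.1 (ge_of_tendsto htend (eventually_mem_nhdsWithin.mono hle))
  have hsq : ∫ u, ‖F u‖ ^ 2 = 0 := by
    have hcast : ((∫ u, ‖F u‖ ^ 2 : ℝ) : ℂ) = 0 := by
      rw [← hq, ← integral_complex_ofReal]
      change _ = ∫ x : K, F x * star (F x) ∂(volume.comap Subtype.val)
      rw [integral_subtype_comap measurableSet_closedBall (fun x => F x * star (F x)),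
        setIntegral_eq_integral_of_forall_compl_eq_zero]
      · congr 1 with x
        rw [Complex.star_def, Complex.mul_conj, Complex.normSq_eq_norm_sq]
      · intro x hx
        rw [mem_closedBall_zero_iff, not_le] at hx
        simp [hout x hx]
    exact_mod_cast hcast
  have hci : Integrable fun u => ‖F u‖ ^ 2 := by
    refine Continuous.integrable_of_hasCompactSupport (by fun_prop) <|
      HasCompactSupport.of_support_subset_isCompact hcK fun x hx => ?_
    rw [mem_closedBall_zero_iff]
    by_contra! hlt
    exact hx (by simp [hout x hlt])
  have hae := (integral_eq_zero_iff_of_nonneg (fun u => by positivity) hci).1 hsq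
  have heq := (Continuous.ae_eq_iff_eq volume (by fun_prop) continuous_zero).1 hae
  simpa using congrFun heq u

/-! ### From twisted spherical means to the kernel integral -/

lemma twistedSphericalMean_eq {f : CSpace n → ℂ} (hf : Continuous f) (s : ℝ) (z : CSpace n) :
    twistedSphericalMean f s z =
      (((volume : Measure (CSpace n)).toSphere Set.univ)⁻¹).toReal •
        ∫ x : Metric.sphere (0 : CSpace n) 1, f (z - s • (x : CSpace n)) *
          Complex.exp (Complex.I / 2 *
            (((inner ℂ (s • (x : CSpace n)) z).im : ℝ) : ℂ)) ∂(volume : Measure (CSpace n)).toSphere := by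
  have hinner : ∀ w : CSpace n, ∑ j, z j * (starRingEnd ℂ) (w j) = inner ℂ w z := fun w => by
    simp [PiLp.inner_apply]
  have him := Complex.continuous_im
  have ho := Complex.continuous_ofReal
  simp only [twistedSphericalMean, sphereMeasure, hinner]
  rw [integral_map (Continuous.aemeasurable (by fun_prop))
    (Continuous.aestronglyMeasurable (by fun_prop)), integral_smul_measure]

lemma twistedSphericalMean_eq_zero_of_tsupport_subset {f : CSpace n → ℂ} (hf : Continuous f)
    {r : ℝ} (h : tsupport f ⊆ Metric.closedBall (0 : CSpace n) r) {z : CSpace n} {s : ℝ}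
    (hs : r + ‖z‖ < s) : twistedSphericalMean f s z = 0 := by
  rw [twistedSphericalMean_eq hf, integral_eq_zero_of_ae, smul_zero]
  refine Eventually.of_forall fun x => ?_
  have hx : ‖s • (x : CSpace n)‖ = |s| := by rw [norm_smul, norm_eq_of_mem_sphere, mul_one,
    Real.norm_eq_abs]
  have hz : f (z - s • (x : CSpace n)) = 0 := by
    by_contra hne
    have h1 := mem_closedBall_zero_iff.1 (h (subset_tsupport f hne))
    have h2 := norm_sub_norm_le (s • (x : CSpace n)) z
    rw [norm_sub_rev] at h1
    linarith [le_abs_self s]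
  simp [hz]

/-- Expanding |z - w|² leaves Re⟨z,w⟩/2 - ⟨z,w⟩/2 = (i/2) Im⟨w,z⟩, exactly the twist; the prefactor
is constant on spheres |w| = s. -/
lemma sphere_kernel_eq (f : CSpace n → ℂ) (ψ : ℝ → ℂ) (z w : CSpace n) :
    f (z - w) * Complex.exp (-(‖z - w‖ ^ 2 : ℝ) / 4) *
      (Complex.exp (inner ℂ z (z - w) / 2) * ψ (‖z - w - z‖ ^ 2)) =
    Complex.exp ((‖z‖ ^ 2 - ‖w‖ ^ 2 : ℝ) / 4) * ψ (‖w‖ ^ 2) *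
      (f (z - w) * Complex.exp (Complex.I / 2 * (((inner ℂ w z).im : ℝ) : ℂ))) := by
  have hexp : Complex.exp (-(‖z - w‖ ^ 2 : ℝ) / 4) * Complex.exp (inner ℂ z (z - w) / 2) =
      Complex.exp ((‖z‖ ^ 2 - ‖w‖ ^ 2 : ℝ) / 4) *
        Complex.exp (Complex.I / 2 * (((inner ℂ w z).im : ℝ) : ℂ)) := by
    rw [← Complex.exp_add, ← Complex.exp_add]
    congr 1
    rw [norm_sub_sq (𝕜 := ℂ), inner_sub_right, inner_self_eq_norm_sq_to_K]
    have h1 : (inner ℂ z w).im = -(inner ℂ w z).im := inner_im_symm (𝕜 := ℂ) z w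
    have h2 : inner ℂ z w = ((inner ℂ z w).re : ℂ) + (inner ℂ z w).im * Complex.I :=
      (Complex.re_add_im _).symm
    rw [h1] at h2
    push_cast at h2 ⊢
    simp only [RCLike.re_to_complex, Complex.coe_algebraMap]
    linear_combination (-1 / 2 : ℂ) * h2
  rw [sub_sub_cancel_left, norm_neg]
  linear_combination f (z - w) * ψ (‖w‖ ^ 2) * hexp

/-- Each sphere |w| = s contributes zero: by the vanishing mean if s > r + |z|, by the support of ψ
otherwise. -/
lemma kernelIntegral_eq_zero_of_twistedSphericalMean_eq_zero [Nontrivial (CSpace n)]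
    {f : CSpace n → ℂ} (hf : Continuous f) {r : ℝ}
    (h : ∀ (z : CSpace n) (s : ℝ), r + ‖z‖ < s → twistedSphericalMean f s z = 0)
    (z : CSpace n) {ψ : ℝ → ℂ} (hψ : IsTest ((r + ‖z‖) ^ 2) ψ) :
    kernelIntegral (fun u => f u * Complex.exp (-(‖u‖ ^ 2 : ℝ) / 4)) ψ z = 0 := by
  have hi := integrable_kernel (g := fun u => f u * Complex.exp (-(‖u‖ ^ 2 : ℝ) / 4))
    (by fun_prop) hψ z
  rw [kernelIntegral, ← integral_sub_left_eq_self _ _ z]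
  refine integral_eq_zero_of_integral_toSphere_eq_zero volume (hi.comp_sub_left z) fun s hs => ?_
  simp only [sphere_kernel_eq]
  have hx : ∀ x : Metric.sphere (0 : CSpace n) 1, ‖s • (x : CSpace n)‖ = s := fun x => by
    rw [norm_smul, norm_eq_of_mem_sphere, mul_one, Real.norm_eq_abs, abs_of_pos hs]
  simp only [hx]
  rw [integral_const_mul]
  by_cases hlt : r + ‖z‖ < s
  · have := h z s hlt
    rw [twistedSphericalMean_eq hf, smul_eq_zero] at this
    rcases this with h0 | h0
    -- The normalizing constant is nonzero, as the sphere has finite positive mass.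
    · rw [ENNReal.toReal_eq_zero_iff, ENNReal.inv_eq_zero, ENNReal.inv_eq_top] at h0
      rcases h0 with h0 | h0
      · exact absurd h0 (measure_ne_top _ _)
      · exact absurd (Measure.measure_univ_eq_zero.1 h0) (Measure.toSphere_ne_zero _)
    · rw [h0, mul_zero]
  · rw [hψ.eq_zero_of_le (pow_le_pow_left₀ hs.le (not_lt.1 hlt) 2)]
    simp

/-! ### Monomials and integrability -/

lemma norm_prod_map_le (q : CSpace n → CSpace n → ℂ) (hq : ∀ u v, ‖q u v‖ ≤ ‖u‖ * ‖v‖)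
    (L : List (CSpace n)) :
    ∃ B : ℝ, 0 ≤ B ∧ ∀ u, ‖(L.map (q u)).prod‖ ≤ B * ‖u‖ ^ L.length := by
  induction L with
  | nil => exact ⟨1, zero_le_one, fun u => by simp⟩
  | cons v L ih =>
    obtain ⟨B, hB, h⟩ := ih
    refine ⟨B * ‖v‖, by positivity, fun u => ?_⟩
    rw [List.map_cons, List.prod_cons, norm_mul, List.length_cons]
    calc _ ≤ (‖u‖ * ‖v‖) * (B * ‖u‖ ^ L.length) :=
          mul_le_mul (hq u v) (h u) (norm_nonneg _) (by positivity)
      _ = _ := by ring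

lemma continuous_prod_map {q : CSpace n → CSpace n → ℂ} (hq : ∀ v, Continuous fun u => q u v)
    (L : List (CSpace n)) : Continuous fun u => (L.map (q u)).prod := by
  induction L with
  | nil => simpa using continuous_const
  | cons v L ih =>
    simp only [List.map_cons, List.prod_cons]
    exact (hq v).mul ih

lemma integrable_of_forall_pow_mul_norm_le {F p : CSpace n → ℂ} (hF : Continuous F)
    (hp : Continuous p) (hdecay : ∀ k : ℕ, ∃ C : ℝ, ∀ u, ‖u‖ ^ k * ‖F u‖ ≤ C) {B : ℝ} (hB : 0 ≤ B)
    {m : ℕ} (hpB : ∀ u, ‖p u‖ ≤ B * ‖u‖ ^ m) : Integrable fun u => F u * p u := by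
  -- One power more than the real dimension makes (1 + ‖u‖)^{-N} integrable.
  set N := Module.finrank ℝ (CSpace n) + 1 with hN
  obtain ⟨C₁, h1⟩ := hdecay m
  obtain ⟨C₂, h2⟩ := hdecay (m + N)
  have hint := (integrable_one_add_norm (E := CSpace n) (μ := volume) (r := N)
    (by rw [hN]; push_cast; linarith)).const_mul (B * (2 ^ (N - 1) * (C₁ + C₂)))
  refine hint.mono' (by fun_prop) (Eventually.of_forall fun u => ?_)
  have hpos : 0 < (1 + ‖u‖) ^ N := by positivity
  rw [Real.rpow_neg (by positivity), Real.rpow_natCast, ← div_eq_mul_inv, le_div_iff₀ hpos, norm_mul]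
  have hadd := add_pow_le zero_le_one (norm_nonneg u) N
  rw [one_pow] at hadd
  calc ‖F u‖ * ‖p u‖ * (1 + ‖u‖) ^ N
      ≤ ‖F u‖ * (B * ‖u‖ ^ m) * (2 ^ (N - 1) * (1 + ‖u‖ ^ N)) := by
        gcongr
        exact hpB u
    _ = B * (2 ^ (N - 1) * (‖u‖ ^ m * ‖F u‖ + ‖u‖ ^ (m + N) * ‖F u‖)) := by ring
    _ ≤ _ := by
        gcongr
        exacts [h1 u, h2 u]

/-- The monomial `∏ v̄·u` over `M` times `∏ v·ū` over `L`. -/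
noncomputable def innerMonomial (L M : List (CSpace n)) (u : CSpace n) : ℂ :=
  (L.map fun v => inner ℂ u v).prod * (M.map fun v => inner ℂ v u).prod

lemma continuous_innerMonomial (L M : List (CSpace n)) : Continuous (innerMonomial L M) :=
  (continuous_prod_map (fun v => by fun_prop) L).mul (continuous_prod_map (fun v => by fun_prop) M)

lemma integrable_mul_innerMonomial {F : CSpace n → ℂ} (hF : Continuous F)
    (hdecay : ∀ k : ℕ, ∃ C : ℝ, ∀ u, ‖u‖ ^ k * ‖F u‖ ≤ C) (L M : List (CSpace n)) :
    Integrable fun u => F u * innerMonomial L M u := by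
  obtain ⟨B, hB, h⟩ := norm_prod_map_le (fun u v : CSpace n => inner ℂ u v)
    (fun u v => norm_inner_le_norm u v) L
  obtain ⟨B', hB', h'⟩ := norm_prod_map_le (fun u v : CSpace n => inner ℂ v u)
    (fun u v => (norm_inner_le_norm v u).trans_eq (mul_comm _ _)) M
  refine integrable_of_forall_pow_mul_norm_le hF (continuous_innerMonomial L M) hdecay
    (mul_nonneg hB hB') (m := L.length + M.length) fun u => ?_
  rw [innerMonomial, norm_mul]
  calc _ ≤ (B * ‖u‖ ^ L.length) * (B' * ‖u‖ ^ M.length) :=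
        mul_le_mul (h u) (h' u) (norm_nonneg _) (by positivity)
    _ = _ := by ring

/-! ### Vanishing of the weighted moments -/

section Moments

variable {f : CSpace n → ℂ} (hf : Continuous f)
  (hdecay : ∀ k : ℕ, ∃ C : ℝ, ∀ u, ‖u‖ ^ k * ‖f u * Complex.exp ((‖u‖ ^ 2 : ℝ) / 4)‖ ≤ C)
include hf hdecay

lemma integrable_gaussian_mul_innerMonomial_mul_exp (L M : List (CSpace n)) (z : CSpace n) :
    Integrable fun u => f u * Complex.exp (-(‖u‖ ^ 2 : ℝ) / 4) * innerMonomial L M u *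
      Complex.exp (inner ℂ z u / 2) := by
  have hc := continuous_innerMonomial L M
  have hint := (integrable_mul_innerMonomial (F := fun u => f u * Complex.exp ((‖u‖ ^ 2 : ℝ) / 4))
    (by fun_prop) hdecay L M).norm.mul_const (Real.exp (‖z‖ ^ 2 / 8))
  refine hint.mono' (by fun_prop) (Eventually.of_forall fun u => ?_)
  -- The coefficient 1/2 of ‖u‖² turns the weight e^{-|u|²/4} into e^{|u|²/4}, the growth allowed by
  -- the decay of f.
  have hre : (inner ℂ z u / 2 : ℂ).re ≤ ‖z‖ ^ 2 / 8 + ‖u‖ ^ 2 / 2 := by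
    have h1 : (inner ℂ z u).re ≤ ‖z‖ * ‖u‖ := re_inner_le_norm (𝕜 := ℂ) z u
    have h2 : (inner ℂ z u / 2 : ℂ).re = (inner ℂ z u).re / 2 := by simp
    rw [h2]
    nlinarith [sq_nonneg (‖z‖ - 2 * ‖u‖)]
  have h3 : ∀ t : ℝ, ‖Complex.exp ((t : ℂ) / 4)‖ = Real.exp (t / 4) := fun t => by
    rw [Complex.norm_exp]; simp
  simp only [norm_mul]
  rw [h3, ← Complex.ofReal_neg, h3, Complex.norm_exp]
  calc ‖f u‖ * Real.exp (-‖u‖ ^ 2 / 4) * ‖innerMonomial L M u‖ * Real.exp (inner ℂ z u / 2 : ℂ).re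
      = ‖f u‖ * ‖innerMonomial L M u‖ *
          Real.exp (-‖u‖ ^ 2 / 4 + (inner ℂ z u / 2 : ℂ).re) := by rw [Real.exp_add]; ring
    _ ≤ ‖f u‖ * ‖innerMonomial L M u‖ * Real.exp (‖u‖ ^ 2 / 4 + ‖z‖ ^ 2 / 8) := by
        exact mul_le_mul_of_nonneg_left (Real.exp_le_exp.2 (by linarith)) (by positivity)
    _ = _ := by rw [Real.exp_add]; ring

variable {r : ℝ}
  (h0 : ∀ (z : CSpace n) (ψ : ℝ → ℂ), IsTest ((r + ‖z‖) ^ 2) ψ →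
    kernelIntegral (fun u => f u * Complex.exp (-(‖u‖ ^ 2 : ℝ) / 4)) ψ z = 0)
include h0

lemma kernelIntegral_mul_innerMonomial_nil_eq_zero (L : List (CSpace n)) (z : CSpace n) (ψ : ℝ → ℂ)
    (hψ : IsTest ((r + ‖z‖) ^ 2) ψ) :
    kernelIntegral (fun u => f u * Complex.exp (-(‖u‖ ^ 2 : ℝ) / 4) * innerMonomial L [] u)
      ψ z = 0 := by
  induction L generalizing z ψ with
  | nil => simpa [innerMonomial] using h0 z ψ hψ
  | cons v L ih =>
    have hc := continuous_innerMonomial L ([] : List (CSpace n))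
    have heq : (fun u => f u * Complex.exp (-(‖u‖ ^ 2 : ℝ) / 4) * innerMonomial (v :: L) [] u) =
        fun u => f u * Complex.exp (-(‖u‖ ^ 2 : ℝ) / 4) * innerMonomial L [] u *
          (starRingEnd ℂ) (inner ℂ v u) := by
      funext u
      rw [inner_conj_symm]
      simp only [innerMonomial, List.map_cons, List.prod_cons]
      ring
    rw [heq]
    refine kernelIntegral_mul_conj_inner_eq_zero (by fun_prop) ih v (fun z => ?_) z ψ hψ
    exact (integrable_gaussian_mul_innerMonomial_mul_exp hf hdecay (v :: L) [] z).congr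
      (Eventually.of_forall fun u => congrArg (· * _) (congrFun heq u))

/-- The ū factors are inserted first, while vanishing still holds for all test functions; each u
factor then adds one derivative. -/
lemma kernelIntegral_mul_innerMonomial_deriv_iterate_eq_zero (L M : List (CSpace n)) (z : CSpace n)
    (φ : ℝ → ℂ) (hφ : IsTest ((r + ‖z‖) ^ 2) φ) :
    kernelIntegral (fun u => f u * Complex.exp (-(‖u‖ ^ 2 : ℝ) / 4) * innerMonomial L M u)
      (fun t => Complex.exp (t / 2) * deriv^[M.length] φ t) z = 0 := by
  induction M generalizing z φ with
  | nil =>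
    exact kernelIntegral_mul_innerMonomial_nil_eq_zero hf hdecay h0 L z _ (hφ.mul contDiff_exp_half)
  | cons v M ih =>
    have hc := continuous_innerMonomial L M
    have heq : (fun u => f u * Complex.exp (-(‖u‖ ^ 2 : ℝ) / 4) * innerMonomial L (v :: M) u) =
        fun u => f u * Complex.exp (-(‖u‖ ^ 2 : ℝ) / 4) * innerMonomial L M u * inner ℂ v u := by
      funext u
      simp only [innerMonomial, List.map_cons, List.prod_cons]
      ring
    rw [heq]
    exact kernelIntegral_mul_inner_eq_zero (by fun_prop) M.length ih v z φ hφ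

lemma integral_mul_innerMonomial_mul_test_eq_zero (L M : List (CSpace n)) {φ : ℝ → ℂ}
    (hφ : IsTest (r ^ 2) φ) :
    ∫ u, f u * Complex.exp ((‖u‖ ^ 2 : ℝ) / 4) * φ (‖u‖ ^ 2) * innerMonomial L M u = 0 := by
  have hc := continuous_innerMonomial L M
  have hg : Continuous fun u => f u * Complex.exp (-(‖u‖ ^ 2 : ℝ) / 4) * innerMonomial L M u := by
    fun_prop
  have hexp : ∀ u : CSpace n, Complex.exp (-(‖u‖ ^ 2 : ℝ) / 4) * Complex.exp ((‖u‖ ^ 2 : ℝ) / 2) =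
      Complex.exp ((‖u‖ ^ 2 : ℝ) / 4) := fun u => by
    rw [← Complex.exp_add]; congr 1; ring
  have key := eq_zero_of_deriv_iterate_eq_zero_of_tendsto (c := r ^ 2)
    (T := fun φ => kernelIntegral (fun u => f u * Complex.exp (-(‖u‖ ^ 2 : ℝ) / 4) *
      innerMonomial L M u) (fun t => Complex.exp (t / 2) * φ t) 0)
    (fun φ ψ h h' => ?_) M.length (fun φ h => ?_) (fun φ h => ?_) hφ
  · rw [← key, kernelIntegral]
    congr 1 with u
    simp only [inner_zero_left, zero_div, Complex.exp_zero, sub_zero, one_mul]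
    linear_combination -f u * φ (‖u‖ ^ 2) * innerMonomial L M u * hexp u
  · rw [← kernelIntegral_sub hg (h.mul contDiff_exp_half) (h'.mul contDiff_exp_half)]
    congr 1
    funext t
    simp [mul_sub]
  · exact kernelIntegral_mul_innerMonomial_deriv_iterate_eq_zero hf hdecay h0 L M 0 φ (by simpa using h)
  -- At z = 0 the factors e^{-|u|²/4} and e^{|u|²/2} multiply to e^{|u|²/4}, so the decay hypothesis
  -- gives integrability.
  · refine tendsto_kernelIntegral_translate (w := fun t : ℝ => Complex.exp (t / 2)) (by fun_prop) hg
      ?_ h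
    refine (integrable_mul_innerMonomial (by fun_prop) hdecay L M).congr
      (Eventually.of_forall fun u => ?_)
    simp only [inner_zero_left, zero_div, Complex.exp_zero, sub_zero, one_mul]
    linear_combination -f u * innerMonomial L M u * hexp u

lemma eq_zero_of_kernelIntegral_eq_zero (hr : 0 ≤ r) {u : CSpace n} (hu : r < ‖u‖) : f u = 0 := by
  have hlt : r ^ 2 < ‖u‖ ^ 2 := pow_lt_pow_left₀ hu hr two_ne_zero
  set δ := (‖u‖ ^ 2 - r ^ 2) / 2 with hδ
  -- A bump equal to 1 at ‖u‖², with radius half the gap to r², keeps its support beyond r².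
  let b : ContDiffBump (‖u‖ ^ 2) := ⟨δ / 2, δ, by rw [hδ]; linarith, by rw [hδ]; linarith⟩
  have hb : IsTest (r ^ 2) fun t => (b t : ℂ) := by
    refine ⟨Complex.ofRealCLM.contDiff.comp b.contDiff, ‖u‖ ^ 2 - δ, ‖u‖ ^ 2 + δ,
      by rw [hδ]; linarith, fun t ht => ?_⟩
    have : t ∈ Function.support b := fun h => ht (by simp [h])
    rw [b.support_eq, Real.ball_eq_Ioo] at this
    exact Set.Ioo_subset_Icc_self this
  obtain ⟨R, hR⟩ := hb.exists_norm_le (n := n)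
  have hbc := hb.continuous
  have := eq_zero_of_forall_setIntegral_mul_prod_inner_eq_zero
    (F := fun u => f u * Complex.exp ((‖u‖ ^ 2 : ℝ) / 4) * (b (‖u‖ ^ 2) : ℂ))
    ((by fun_prop : Continuous fun u => f u * Complex.exp ((‖u‖ ^ 2 : ℝ) / 4)).mul
      (hbc.comp (by fun_prop : Continuous fun u : CSpace n => ‖u‖ ^ 2))) R
    (fun w hw => by
      have := hR 0 w (by simpa using hw)
      rw [sub_zero] at this
      rw [this, mul_zero])
    (fun L M => integral_mul_innerMonomial_mul_test_eq_zero hf hdecay h0 L M hb) u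
  have hbu : b (‖u‖ ^ 2) = 1 := b.one_of_mem_closedBall
    (Metric.mem_closedBall_self (by rw [hδ] at *; exact b.rIn_pos.le))
  simpa [hbu, Complex.exp_ne_zero] using this

end Moments

theorem theorem1p2 (n : ℕ) (hn : 1 ≤ n) (r : ℝ) (hr : 0 ≤ r)
    (f : CSpace n → ℂ) (hf : Continuous f)
    (hdecay : ∀ k : ℕ, ∃ C : ℝ, ∀ z : CSpace n,
      ‖z‖ ^ k * Real.exp (‖z‖ ^ 2 / 4) * ‖f z‖ ≤ C) :
    tsupport f ⊆ Metric.closedBall (0 : CSpace n) r ↔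
      ∀ (z : CSpace n) (s : ℝ), r + ‖z‖ < s → twistedSphericalMean f s z = 0 := by
  have : Nonempty (Fin n) := ⟨⟨0, hn⟩⟩
  -- Nontriviality makes the surface measure of the unit sphere nonzero.
  have : Nontrivial (CSpace n) := (WithLp.equiv 2 (Fin n → ℂ)).nontrivial
  refine ⟨fun h z s hs => twistedSphericalMean_eq_zero_of_tsupport_subset hf h hs, fun h => ?_⟩
  have hdecay' : ∀ k : ℕ, ∃ C : ℝ, ∀ u : CSpace n,
      ‖u‖ ^ k * ‖f u * Complex.exp ((‖u‖ ^ 2 : ℝ) / 4)‖ ≤ C := fun k => by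
    obtain ⟨C, hC⟩ := hdecay k
    refine ⟨C, fun u => ?_⟩
    have h1 : ‖Complex.exp ((‖u‖ ^ 2 : ℝ) / 4 : ℂ)‖ = Real.exp (‖u‖ ^ 2 / 4) := by
      rw [Complex.norm_exp, ← Complex.ofReal_ofNat, ← Complex.ofReal_div, Complex.ofReal_re]
    rw [norm_mul, h1]
    linarith [hC u]
  refine closure_minimal (fun u hu => ?_) Metric.isClosed_closedBall
  rw [mem_closedBall_zero_iff]
  by_contra! hlt
  exact hu (eq_zero_of_kernelIntegral_eq_zero hf hdecay'
    (fun z ψ hψ => kernelIntegral_eq_zero_of_twistedSphericalMean_eq_zero hf h z hψ) hr hlt)
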